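/- Let $d\in\mathbb{N}$, and let $A\in\mathbb{C}^{d\times d}$ and $x,y\in\mathbb{C}^d$ have entries that are algebraic numbers. Identify $\mathbb{C}^d$ with $\mathbb{R}^{2d}$ through real and imaginary parts, and call a subset of $\mathbb{C}^d$ semialgebraic if it is the set of real solutions of a Boolean combination of polynomial inequalities with integer coefficients. A semialgebraic invariant for $(A,x,y)$ is a semialgebraic set $\mathcal{P}\subseteq\mathbb{C}^d$ such that $A\mathcal{P}\subseteq\mathcal{P}$, $x\in\mathcal{P}$ and $y\notin\mathcal{P}$. Then a topologically closed semialgebraic invariant for $(A,x,y)$ exists if and only if $y\notin\overline{\{A^n x : n\in\mathbb{N}\}}$, where $\mathbb{N}$ contains $0$ and the bar denotes topological closure in $\mathbb{C}^d$. -/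

import Mathlib

open scoped Matrix

namespace OrbitProblem

/-- A subset of `ℝ^σ` is semialgebraic if it is the solution set of a Boolean combination of
polynomial inequalities with integer coefficients. (Strict inequalities, equations and the trivial
sets arise from the inequalities `0 ≤ p` through Boolean operations.) -/
def IsRealSemialgebraic {σ : Type*} (S : Set (σ → ℝ)) : Prop :=
  S ∈ BooleanSubalgebra.closure
    (Set.range fun p : MvPolynomial σ ℤ => {v : σ → ℝ | 0 ≤ MvPolynomial.aeval v p})

/-- The identification of `ℂ^d` with `ℝ^{2d}`: the real parts of the coordinates followed by their
imaginary parts. -/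
def complexEquivReal (d : ℕ) : (Fin d → ℂ) ≃ (Fin d ⊕ Fin d → ℝ) where
  toFun z := Sum.elim (fun i => (z i).re) (fun i => (z i).im)
  invFun v i := ⟨v (Sum.inl i), v (Sum.inr i)⟩
  left_inv _ := rfl
  right_inv v := by
    funext s
    cases s <;> rfl

/-- A subset of `ℂ^d` is semialgebraic if it is so as a subset of `ℝ^{2d}`. -/
def IsSemialgebraic {d : ℕ} (P : Set (Fin d → ℂ)) : Prop :=
  IsRealSemialgebraic (complexEquivReal d '' P)

/-- An Orbit instance: a square matrix and two vectors, all with (complex) algebraic entries. -/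
structure OrbitInstance (d : ℕ) where
  A : Matrix (Fin d) (Fin d) ℂ
  x : Fin d → ℂ
  y : Fin d → ℂ
  algebraic_A : ∀ i j, IsAlgebraic ℚ (A i j)
  algebraic_x : ∀ i, IsAlgebraic ℚ (x i)
  algebraic_y : ∀ i, IsAlgebraic ℚ (y i)

/-- The orbit `{A ^ n x : n ∈ ℕ}` (with `n = 0` included). -/
def OrbitInstance.orbit {d : ℕ} (l : OrbitInstance d) : Set (Fin d → ℂ) :=
  Set.range fun n : ℕ => (l.A ^ n) *ᵥ l.x

/-- `P` is a non-reachability invariant: `A P ⊆ P`, `x ∈ P` and `y ∉ P`. -/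
structure OrbitInstance.IsInvariant {d : ℕ} (l : OrbitInstance d) (P : Set (Fin d → ℂ)) : Prop where
  stable : (fun z => l.A *ᵥ z) '' P ⊆ P
  source_mem : l.x ∈ P
  target_notMem : l.y ∉ P

end OrbitProblem

/-! A closed invariant contains the orbit, hence its closure, so it excludes `y` only if `y` is
outside the closure. For the converse, decompose the functionals with algebraic coefficients into
generalized eigenvectors of the transposed action, and work modulo those vanishing on the orbit. If
`y` is outside the span of the orbit, the span is an invariant. Otherwise several situations each
give a stable closed set that the orbit enters and that misses `y`: an eigenvalue of modulus above 1
(a coordinate grows), a nontrivial Jordan block of modulus 1 (a quadratic quantity grows), an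
eigenvalue of modulus below 1 with a nonzero coordinate of `y` (nested discs contract), or a
rotation-invariant monomial separating `x` from `y` (a level set). Adjoining finitely many iterates
yields the invariant (`exists_invariant_of_eventual`).

If none of these occurs, only the rotating coordinates matter. `frequently_norm_pow_mul_sub_lt`, a
Kronecker-type theorem proved by averaging and Stone–Weierstrass, then puts `y` in the orbit
closure, a contradiction.

These sets have algebraic coefficients, while semialgebraicity asks for integer ones.
`isRealSemialgebraic_nonneg` bridges the gap without quantifier elimination: the sign of a linear
form over a real number field is read off from the coefficients of norm polynomials, after
multiplication by a suitable field element. -/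

namespace OrbitProblem

open MvPolynomial

/-! ### Semialgebraic sets: Boolean operations, polynomial preimages, rational coefficients -/

section Basic

variable {σ τ : Type*}

theorem IsRealSemialgebraic.compl {S : Set (σ → ℝ)} (h : IsRealSemialgebraic S) :
    IsRealSemialgebraic Sᶜ := BooleanSubalgebra.compl_mem h

theorem IsRealSemialgebraic.union {S S' : Set (σ → ℝ)} (h : IsRealSemialgebraic S)
    (h' : IsRealSemialgebraic S') : IsRealSemialgebraic (S ∪ S') :=
  BooleanSubalgebra.sup_mem h h'

theorem IsRealSemialgebraic.inter {S S' : Set (σ → ℝ)} (h : IsRealSemialgebraic S)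
    (h' : IsRealSemialgebraic S') : IsRealSemialgebraic (S ∩ S') :=
  BooleanSubalgebra.inf_mem h h'

theorem isRealSemialgebraic_univ : IsRealSemialgebraic (Set.univ : Set (σ → ℝ)) :=
  BooleanSubalgebra.top_mem

theorem isRealSemialgebraic_empty : IsRealSemialgebraic (∅ : Set (σ → ℝ)) :=
  BooleanSubalgebra.bot_mem

theorem IsRealSemialgebraic.biInter {ι : Type*} {I : Set ι} (hI : I.Finite)
    {S : ι → Set (σ → ℝ)} (h : ∀ i ∈ I, IsRealSemialgebraic (S i)) :
    IsRealSemialgebraic (⋂ i ∈ I, S i) := by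
  induction I, hI using Set.Finite.induction_on with
  | empty => simpa using isRealSemialgebraic_univ
  | insert _ _ ih =>
    rw [Set.biInter_insert]
    exact (h _ (Set.mem_insert _ _)).inter (ih fun i hi => h i (Set.mem_insert_of_mem _ hi))

theorem IsRealSemialgebraic.biUnion {ι : Type*} {I : Set ι} (hI : I.Finite)
    {S : ι → Set (σ → ℝ)} (h : ∀ i ∈ I, IsRealSemialgebraic (S i)) :
    IsRealSemialgebraic (⋃ i ∈ I, S i) := by
  induction I, hI using Set.Finite.induction_on with
  | empty => simpa using isRealSemialgebraic_empty
  | insert _ _ ih =>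
    rw [Set.biUnion_insert]
    exact (h _ (Set.mem_insert _ _)).union (ih fun i hi => h i (Set.mem_insert_of_mem _ hi))

theorem isRealSemialgebraic_nonneg_int (p : MvPolynomial σ ℤ) :
    IsRealSemialgebraic {v : σ → ℝ | 0 ≤ aeval v p} :=
  BooleanSubalgebra.subset_closure ⟨p, rfl⟩

/-- Preimages under polynomial maps with integer coefficients. -/
theorem IsRealSemialgebraic.preimage {S : Set (τ → ℝ)} (h : IsRealSemialgebraic S)
    (p : τ → MvPolynomial σ ℤ) :
    IsRealSemialgebraic {v : σ → ℝ | (fun i => aeval v (p i)) ∈ S} := by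
  unfold IsRealSemialgebraic at h
  induction h using BooleanSubalgebra.closure_bot_sup_induction with
  | mem x hx =>
    obtain ⟨q, rfl⟩ := hx
    have := isRealSemialgebraic_nonneg_int (bind₁ p q)
    simpa [aeval_bind₁] using this
  | bot => exact isRealSemialgebraic_empty
  | sup x _ y _ hx hy => exact hx.union hy
  | compl x _ hx => exact hx.compl

theorem exists_nat_smul_eq_map_int (p : MvPolynomial σ ℚ) :
    ∃ (n : ℕ) (q : MvPolynomial σ ℤ), 0 < n ∧ n • p = map (Int.castRingHom ℚ) q := by
  induction p using MvPolynomial.induction_on' with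
  | monomial u a =>
    refine ⟨a.den, monomial u a.num, a.pos, ?_⟩
    rw [map_monomial, ← map_nsmul]
    congr 1
    rw [nsmul_eq_mul, mul_comm]
    simp
  | add p q hp hq =>
    obtain ⟨n, p', hn, hp⟩ := hp
    obtain ⟨m, q', hm, hq⟩ := hq
    refine ⟨n * m, m • p' + n • q', Nat.mul_pos hn hm, ?_⟩
    rw [map_add, map_nsmul, map_nsmul, ← hp, ← hq, smul_add, smul_smul, smul_smul, mul_comm m n]

theorem isRealSemialgebraic_nonneg_rat (p : MvPolynomial σ ℚ) :
    IsRealSemialgebraic {v : σ → ℝ | 0 ≤ aeval v p} := by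
  obtain ⟨n, q, hn, h⟩ := exists_nat_smul_eq_map_int p
  have key (v : σ → ℝ) : (n : ℝ) * aeval v p = aeval v q := by
    have := congrArg (aeval v) h
    rw [map_nsmul, nsmul_eq_mul] at this
    rw [this, ← algebraMap_int_eq, aeval_map_algebraMap]
  convert isRealSemialgebraic_nonneg_int q using 3 with v
  rw [← key v]
  have : (0 : ℝ) < n := by exact_mod_cast hn
  rw [mul_nonneg_iff_of_pos_left this]

end Basic

open MvPolynomial

/-! ### Density of a number field in its complex embeddings -/

section Approximation

open NumberField ComplexConjugate

variable {K : Type*} [Field K] [NumberField K]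

/-- The basis vectors come from elements of `K`, so they have the same symmetry as `τ`; conjugating
the coordinates gives a second expansion of `τ`, and expansions are unique. -/
theorem latticeBasis_repr_conj {τ : (K →+* ℂ) → ℂ}
    (hτ : ∀ φ, τ (ComplexEmbedding.conjugate φ) = conj (τ φ))
    (i : Module.Free.ChooseBasisIndex ℤ (𝓞 K)) :
    conj ((canonicalEmbedding.latticeBasis K).repr τ i) =
      (canonicalEmbedding.latticeBasis K).repr τ i := by
  set B := canonicalEmbedding.latticeBasis K
  have h1 : ∑ i, conj (B.repr τ i) • B i = τ := by
    funext φ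
    have h := congrFun (B.sum_repr τ) (ComplexEmbedding.conjugate φ)
    rw [hτ] at h
    have h' := congrArg conj h
    simp only [Finset.sum_apply, Pi.smul_apply, smul_eq_mul, map_sum, map_mul,
      Complex.conj_conj] at h'
    rw [← h', Finset.sum_apply]
    refine Finset.sum_congr rfl fun j _ => ?_
    simp [B, canonicalEmbedding.latticeBasis_apply, canonicalEmbedding.apply_at]
  have h2 := congrArg (fun t => B.repr t i) h1
  simp only [B.repr_sum_self] at h2
  exact h2

/-- A number field is dense in the conjugation-invariant part of the product of its complex
embeddings. -/
theorem exists_forall_norm_embedding_sub_lt {τ : (K →+* ℂ) → ℂ}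
    (hτ : ∀ φ, τ (ComplexEmbedding.conjugate φ) = conj (τ φ)) {ε : ℝ} (hε : 0 < ε) :
    ∃ g : K, ∀ φ : K →+* ℂ, ‖φ g - τ φ‖ < ε := by
  set B := canonicalEmbedding.latticeBasis K
  let c : Module.Free.ChooseBasisIndex ℤ (𝓞 K) → ℝ := fun i => (B.repr τ i).re
  have hc (i) : (c i : ℂ) = B.repr τ i := Complex.conj_eq_iff_re.mp (latticeBasis_repr_conj hτ i)
  let F : (Module.Free.ChooseBasisIndex ℤ (𝓞 K) → ℝ) → (K →+* ℂ) → ℂ :=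
    fun q => ∑ i, (q i : ℂ) • B i
  have hFc : F c = τ := by
    simp only [F, hc]
    exact B.sum_repr τ
  have hF : Continuous F := by fun_prop
  have hdense : DenseRange
      (fun (q : Module.Free.ChooseBasisIndex ℤ (𝓞 K) → ℚ) i => ((q i : ℚ) : ℝ)) :=
    DenseRange.piMap fun _ => Rat.denseRange_cast
  obtain ⟨q, hq⟩ := hdense.exists_mem_open (Metric.isOpen_ball.preimage hF)
    ⟨c, show F c ∈ Metric.ball τ ε by rw [hFc]; exact Metric.mem_ball_self hε⟩
  -- Rational approximations of the real coordinates of `τ` are the coordinates of an element of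
  -- `K`.
  refine ⟨∑ i, (q i : K) * (integralBasis K i : K), fun φ => ?_⟩
  rw [Set.mem_preimage, mem_ball_iff_norm] at hq
  refine lt_of_eq_of_lt ?_ ((norm_le_pi_norm (F (fun i => ((q i : ℚ) : ℝ)) - τ) φ).trans_lt hq)
  simp [F, B, canonicalEmbedding.latticeBasis_apply, canonicalEmbedding.apply_at]

end Approximation

/-! ### Norm forms -/

section NormForm

variable {K : Type*} [Field K] [NumberField K] {ι : Type*} [Fintype ι]

open Module in
/-- The norm of `∑ X_j b_j` as a polynomial in the indeterminates `X_j`. -/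
noncomputable def normForm (b : ι → K) : MvPolynomial ι ℚ :=
  (∑ j, (Algebra.leftMulMatrix (finBasis ℚ K) (b j)).map fun q => C q * X j).det

theorem aeval_normForm {R : Type*} [CommRing R] [Algebra ℚ R] (b : ι → K) (v : ι → R) :
    aeval v (normForm b) = (∑ j, (Algebra.leftMulMatrix (Module.finBasis ℚ K) (b j)).map
      fun q => algebraMap ℚ R q * v j).det := by
  rw [normForm, AlgHom.map_det]
  congr 1
  ext i k
  simp [Matrix.sum_apply]

/-- At rational points this is the product formula for the norm; both sides are continuous and
rational points are dense. -/
theorem aeval_normForm_eq_prod (b : ι → K) (v : ι → ℝ) :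
    ((aeval v (normForm b) : ℝ) : ℂ) = ∏ φ : K →+* ℂ, ∑ j, (v j : ℂ) * φ (b j) := by
  have hdense : DenseRange (fun (q : ι → ℚ) i => ((q i : ℚ) : ℝ)) :=
    DenseRange.piMap fun _ => Rat.denseRange_cast
  have hf : Continuous fun v : ι → ℝ => ((aeval v (normForm b) : ℝ) : ℂ) := by
    simp only [aeval_normForm]
    refine Complex.continuous_ofReal.comp (Continuous.matrix_det ?_)
    refine continuous_finsetSum _ fun j _ => ?_
    exact continuous_matrix fun i k => by simpa using by fun_prop
  have hg : Continuous fun v : ι → ℝ => ∏ φ : K →+* ℂ, ∑ j, (v j : ℂ) * φ (b j) := by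
    fun_prop
  refine congrFun (hdense.equalizer hf hg (funext fun q => ?_)) v
  have h1 : aeval q (normForm b) = Algebra.norm ℚ (∑ j, q j • b j) := by
    rw [aeval_normForm, Algebra.norm_eq_matrix_det (Module.finBasis ℚ K), map_sum]
    congr 1
    refine Finset.sum_congr rfl fun j _ => ?_
    ext i k
    simp [mul_comm]
  have h2 : aeval (fun i => ((q i : ℚ) : ℝ)) (normForm b) = ((aeval q (normForm b) : ℚ) : ℝ) := by
    have := aeval_algebraMap_apply (A := ℚ) ℝ q (normForm b)
    simpa [Function.comp_def] using this
  have h3 := Algebra.norm_eq_prod_embeddings ℚ ℂ (∑ j, q j • b j)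
  simp only [Function.comp_apply]
  rw [h2, h1]
  simp only [eq_ratCast] at h3
  rw [Complex.ofReal_ratCast, h3]
  symm
  refine Fintype.prod_equiv (RingHom.equivRatAlgHom K ℂ) _ _ fun φ => ?_
  simp [Rat.smul_def, RingHom.equivRatAlgHom_apply]

end NormForm

open MvPolynomial

/-! ### Half-spaces with real algebraic coefficients -/

section LinearForm

theorem eval_map_optionEquivLeft {ι : Type*} (v : ι → ℝ) (t : ℝ) (f : MvPolynomial (Option ι) ℚ) :
    ((optionEquivLeft ℚ ι f).map (aeval v : MvPolynomial ι ℚ →ₐ[ℚ] ℝ).toRingHom).eval t =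
      aeval (fun o : Option ι => o.elim t v) f := by
  induction f using MvPolynomial.induction_on with
  | C a => simp [optionEquivLeft_C]
  | add p q hp hq => rw [map_add, Polynomial.map_add, Polynomial.eval_add, hp, hq, map_add]
  | mul_X p o hp =>
    rw [map_mul, Polynomial.map_mul, Polynomial.eval_mul, hp, map_mul]
    congr 1
    cases o <;> simp [optionEquivLeft_X_some, optionEquivLeft_X_none]

theorem coeff_prod_nonneg {α : Type*} (s : Finset α) (p : α → Polynomial ℝ)
    (h : ∀ a ∈ s, ∀ k, 0 ≤ (p a).coeff k) (k : ℕ) : 0 ≤ (∏ a ∈ s, p a).coeff k := by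
  classical
  induction s using Finset.induction_on generalizing k with
  | empty =>
    rw [Finset.prod_empty, Polynomial.coeff_one]
    split_ifs <;> simp
  | insert a s ha ih =>
    rw [Finset.prod_insert ha, Polynomial.coeff_mul]
    exact Finset.sum_nonneg fun x _ => mul_nonneg (h a (Finset.mem_insert_self _ _) _)
      (ih (fun b hb => h b (Finset.mem_insert_of_mem hb)) _)

theorem eval_pos_of_coeff_nonneg {p : Polynomial ℝ} (hp : p.Monic) (h : ∀ k, 0 ≤ p.coeff k)
    {t : ℝ} (ht : 0 < t) : 0 < p.eval t := by
  rw [Polynomial.eval_eq_sum_range]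
  refine Finset.sum_pos' (fun k _ => mul_nonneg (h k) (pow_nonneg ht.le _))
    ⟨p.natDegree, by simp, ?_⟩
  rw [hp.coeff_natDegree, one_mul]
  exact pow_pos ht _

open NumberField ComplexConjugate

variable {K : Type*} [Field K] [NumberField K] {ι : Type*} [Fintype ι]

/-- The square of the characteristic polynomial of multiplication by `- g * ∑ X_j b_j`, as a
polynomial with coefficients in `ℚ[X]`. -/
noncomputable def squaredCharpoly (b : ι → K) (g : K) : Polynomial (MvPolynomial ι ℚ) :=
  optionEquivLeft ℚ ι (normForm (fun o : Option ι => o.elim 1 fun j => g * b j) ^ 2)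

/-- The norm is real, so its square is the norm times its conjugate. This pairs each factor `t + c
φ` with its own conjugate, treating real and complex embeddings alike and giving real quadratic
factors. -/
theorem map_squaredCharpoly (b : ι → K) (g : K) (v : ι → ℝ) (c : (K →+* ℂ) → ℂ)
    (hc : ∀ φ, c φ = φ g * ∑ j, v j * φ (b j)) :
    (squaredCharpoly b g).map (aeval v : MvPolynomial ι ℚ →ₐ[ℚ] ℝ).toRingHom =
      ∏ φ : K →+* ℂ, (Polynomial.X ^ 2 + Polynomial.C (2 * (c φ).re) * Polynomial.X +
        Polynomial.C (Complex.normSq (c φ))) := by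
  refine Polynomial.funext fun t => ?_
  rw [squaredCharpoly, eval_map_optionEquivLeft, map_pow, Polynomial.eval_prod]
  set N : ℝ := aeval (fun o : Option ι => o.elim t v)
    (normForm (fun o : Option ι => o.elim 1 fun j => g * b j))
  have hN : (N : ℂ) = ∏ φ : K →+* ℂ, ((t : ℂ) + c φ) := by
    refine (aeval_normForm_eq_prod _ _).trans (Finset.prod_congr rfl fun φ _ => ?_)
    rw [Fintype.sum_option, hc, Finset.mul_sum]
    simp [mul_left_comm]
  rw [← Complex.ofReal_inj]
  have h2 : ((N ^ 2 : ℝ) : ℂ) = (N : ℂ) * conj (N : ℂ) := by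
    rw [Complex.conj_ofReal]
    push_cast
    ring
  rw [h2, hN, map_prod, ← Finset.prod_mul_distrib, Complex.ofReal_prod]
  refine Finset.prod_congr rfl fun φ _ => ?_
  rw [Complex.mul_conj]
  congr 1
  simp [Complex.normSq_apply]
  ring

/-- A unit `u ∈ {1, -1, i, -i}` with `Re (u * c) = max |Re c| |Im c|`. -/
noncomputable def quarterTurn (c : ℂ) : ℂ :=
  if |c.im| ≤ c.re then 1 else if |c.im| ≤ -c.re then -1 else if 0 < c.im then -Complex.I
  else Complex.I

theorem quarterTurn_mem (c : ℂ) :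
    quarterTurn c ∈ ({1, -1, Complex.I, -Complex.I} : Set ℂ) := by
  unfold quarterTurn
  split_ifs <;> simp

/-- Needed for the conjugation symmetry required by `exists_forall_norm_embedding_sub_lt`. -/
theorem quarterTurn_conj (c : ℂ) : quarterTurn (conj c) = conj (quarterTurn c) := by
  unfold quarterTurn
  simp only [Complex.conj_re, Complex.conj_im, abs_neg, Left.neg_pos_iff]
  split_ifs with h1 h2 h3 h4 h5
  · simp
  · simp
  · linarith
  · simp
  · simp
  · have : c.im = 0 := by linarith
    simp only [this, abs_zero] at h1 h2
    linarith

theorem quarterTurn_ofReal {x : ℝ} (hx : 0 ≤ x) : quarterTurn x = 1 := by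
  simp [quarterTurn, hx]

theorem norm_le_two_mul_re_quarterTurn (c : ℂ) : ‖c‖ ≤ 2 * (quarterTurn c * c).re := by
  have h := Complex.norm_le_abs_re_add_abs_im c
  unfold quarterTurn
  split_ifs with h1 h2 h3
  · have := abs_nonneg c.im
    rw [abs_of_nonneg (this.trans h1)] at h
    simp only [one_mul]
    linarith
  · have := abs_nonneg c.im
    rw [abs_of_nonpos (by linarith : c.re ≤ 0)] at h
    simp only [neg_mul, one_mul, Complex.neg_re]
    linarith
  · have : |c.re| ≤ |c.im| := abs_le.mpr ⟨by linarith, by linarith⟩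
    rw [abs_of_pos h3] at this h
    simp
    linarith
  · have : |c.re| ≤ |c.im| := abs_le.mpr ⟨by linarith, by linarith⟩
    rw [abs_of_nonpos (not_lt.mp h3)] at this h
    simp
    linarith

/-- The exact turn gives real part at least `‖c‖ / 2`, which absorbs the approximation error. -/
theorem re_mul_nonneg_of_norm_sub_le {c g : ℂ} (h : ‖g - quarterTurn c‖ ≤ 1 / 2) :
    0 ≤ (g * c).re := by
  have h1 : (g * c).re = (quarterTurn c * c).re + ((g - quarterTurn c) * c).re := by
    rw [← Complex.add_re]
    ring_nf
  have h2 : |((g - quarterTurn c) * c).re| ≤ 1 / 2 * ‖c‖ :=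
    (Complex.abs_re_le_norm _).trans (by rw [norm_mul]; gcongr)
  have h3 := norm_le_two_mul_re_quarterTurn c
  have h4 := (abs_le.mp h2).1
  linarith

/-- Half-spaces whose coefficients lie in a real number field are semialgebraic. -/
theorem isRealSemialgebraic_linearForm_of_embedding (ψ : K →+* ℝ) (b : ι → K) :
    IsRealSemialgebraic {v : ι → ℝ | 0 ≤ ∑ j, v j * ψ (b j)} := by
  classical
  let ψ' : K →+* ℂ := Complex.ofRealHom.comp ψ
  let good (τ : (K →+* ℂ) → ℂ) (g : K) : Prop := 0 < ψ g ∧ ∀ φ : K →+* ℂ, ‖φ g - τ φ‖ ≤ 1 / 2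
  let S (g : K) : Set (ι → ℝ) := ⋂ k ∈ Set.Iic (squaredCharpoly b g).natDegree,
    {v | 0 ≤ aeval v ((squaredCharpoly b g).coeff k)}
  have hS (g : K) : IsRealSemialgebraic (S g) :=
    IsRealSemialgebraic.biInter (Set.finite_Iic _) fun k _ => isRealSemialgebraic_nonneg_rat _
  have hmemS (g : K) (v : ι → ℝ) : v ∈ S g ↔ ∀ k, 0 ≤
      ((squaredCharpoly b g).map (aeval v : MvPolynomial ι ℚ →ₐ[ℚ] ℝ).toRingHom).coeff k := by
    simp only [S, Set.mem_iInter, Set.mem_Iic, Set.mem_ofPred_eq, Polynomial.coeff_map]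
    refine ⟨fun h k => ?_, fun h k _ => h k⟩
    rcases le_or_gt k (squaredCharpoly b g).natDegree with hk | hk
    · exact h k hk
    · simp [Polynomial.coeff_eq_zero_of_natDegree_lt hk]
  -- Only finitely many patterns of quarter turns exist, and the multiplier `γ τ` depends on the
  -- pattern alone, not on `v`; hence a finite union suffices.
  let T : Set ((K →+* ℂ) → ℂ) :=
    {τ | (∀ φ, τ φ ∈ ({1, -1, Complex.I, -Complex.I} : Set ℂ)) ∧ ∃ g, good τ g}
  have hT : T.Finite :=
    (Set.Finite.pi' fun _ : K →+* ℂ => Set.toFinite ({1, -1, Complex.I, -Complex.I} : Set ℂ)).subset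
      fun τ hτ => hτ.1
  let γ (τ : (K →+* ℂ) → ℂ) : K := if h : ∃ g, good τ g then h.choose else 1
  have hγ (τ) (h : ∃ g, good τ g) : good τ (γ τ) := by
    simp only [γ, dif_pos h]
    exact h.choose_spec
  convert IsRealSemialgebraic.biUnion hT fun τ _ => hS (γ τ)
  ext v
  simp only [Set.mem_iUnion, Set.mem_ofPred_eq, exists_prop]
  set L := ∑ j, v j * ψ (b j)
  let c (φ : K →+* ℂ) : ℂ := ∑ j, v j * φ (b j)
  have hcψ : c ψ' = L := by simp [c, L, ψ']
  constructor
  · intro hL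
    have hconj (φ : K →+* ℂ) : c (ComplexEmbedding.conjugate φ) = conj (c φ) := by
      simp [c]
    -- A multiplier near the turns makes every conjugate of the form have nonnegative real part, so
    -- all quadratic factors have nonnegative coefficients. As `L ≥ 0` needs no turn, `ψ g` is near
    -- 1, hence positive.
    have hex : ∃ g, good (fun φ => quarterTurn (c φ)) g := by
      obtain ⟨g, hg⟩ := exists_forall_norm_embedding_sub_lt
        (τ := fun φ : K →+* ℂ => quarterTurn (c φ))
        (fun φ => by rw [hconj, quarterTurn_conj]) (ε := 1 / 2) (by norm_num)
      refine ⟨g, ?_, fun φ => (hg φ).le⟩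
      have h := hg ψ'
      rw [hcψ, quarterTurn_ofReal hL] at h
      have h' := (Complex.abs_re_le_norm _).trans_lt h
      have h'' : (ψ' g - 1).re = ψ g - 1 := by simp [ψ']
      rw [h''] at h'
      have := (abs_lt.mp h').1
      linarith
    refine ⟨fun φ => quarterTurn (c φ), ⟨fun φ => quarterTurn_mem _, hex⟩, ?_⟩
    have hg := hγ _ hex
    rw [hmemS, map_squaredCharpoly b _ v _ fun φ => rfl]
    refine coeff_prod_nonneg _ _ fun φ _ k => ?_
    have hre : 0 ≤ (φ (γ fun φ => quarterTurn (c φ)) * ∑ j, v j * φ (b j)).re :=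
      re_mul_nonneg_of_norm_sub_le (hg.2 φ)
    simp only [Polynomial.coeff_add, Polynomial.coeff_C_mul, Polynomial.coeff_X_pow,
      Polynomial.coeff_X, Polynomial.coeff_C]
    have := Complex.normSq_nonneg (φ (γ fun φ => quarterTurn (c φ)) * ∑ j, v j * φ (b j))
    refine add_nonneg (add_nonneg ?_ (mul_nonneg (by positivity) ?_)) ?_ <;> split_ifs <;>
      first | assumption | norm_num
  · rintro ⟨τ, ⟨-, hex⟩, hv⟩
    obtain ⟨hpos, -⟩ := hγ τ hex
    set g := γ τ
    by_contra! hL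
    rw [hmemS] at hv
    have hP := map_squaredCharpoly b g v _ fun φ => rfl
    have hmonic : ((squaredCharpoly b g).map
        (aeval v : MvPolynomial ι ℚ →ₐ[ℚ] ℝ).toRingHom).Monic := by
      rw [hP]
      refine Polynomial.monic_prod_of_monic _ _ fun φ _ => ?_
      monicity!
    -- The factor at `ψ'` is `(t + ψ g * L) ^ 2`. If `L < 0` it has a positive root, impossible for
    -- a monic polynomial with nonnegative coefficients.
    have h := eval_pos_of_coeff_nonneg hmonic hv (t := -(ψ g * L)) (by nlinarith)
    rw [hP, Polynomial.eval_prod, Finset.prod_eq_zero (Finset.mem_univ ψ')] at h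
    · exact lt_irrefl _ h
    · have : ψ' g * ∑ j, v j * ψ' (b j) = ((ψ g * L : ℝ) : ℂ) := by simp [ψ', L]
      rw [this, Complex.ofReal_re, Complex.normSq_ofReal]
      simp
      ring

/-- Half-spaces with real algebraic coefficients are semialgebraic. -/
theorem isRealSemialgebraic_linearForm (b : ι → ℝ) (hb : ∀ j, IsAlgebraic ℚ (b j)) :
    IsRealSemialgebraic {v : ι → ℝ | 0 ≤ ∑ j, v j * b j} := by
  let K := IntermediateField.adjoin ℚ (Set.range b)
  have : FiniteDimensional ℚ K := IntermediateField.finiteDimensional_adjoin (by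
    rintro _ ⟨j, rfl⟩
    exact (hb j).isIntegral)
  have : NumberField K := { to_charZero := inferInstance, to_finiteDimensional := this }
  exact isRealSemialgebraic_linearForm_of_embedding (algebraMap K ℝ)
    fun j => ⟨b j, IntermediateField.subset_adjoin _ _ ⟨j, rfl⟩⟩

/-- Solution sets of polynomial inequalities with real algebraic coefficients are semialgebraic. -/
theorem isRealSemialgebraic_nonneg {σ : Type*} (p : MvPolynomial σ (algebraicClosure ℚ ℝ)) :
    IsRealSemialgebraic {v : σ → ℝ | 0 ≤ aeval v p} := by
  let c (m : σ →₀ ℕ) : algebraicClosure ℚ ℝ := coeff m p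
  -- A polynomial is a linear form in its monomials, and the monomial map has integer coefficients.
  have h := (isRealSemialgebraic_linearForm (fun m : p.support => (c m : ℝ))
    fun m => mem_algebraicClosure_iff.mp (c m).2).preimage
      fun m => (monomial (m : σ →₀ ℕ) (1 : ℤ))
  convert h using 3 with v
  simp only [Set.mem_ofPred_eq, aeval_monomial, map_one, one_mul]
  rw [Finset.sum_coe_sort p.support fun m => (m.prod fun i k => v i ^ k) * (c m : ℝ)]
  rw [aeval_def, eval₂_eq]
  refine iff_of_eq (congrArg _ (Finset.sum_congr rfl fun m _ => ?_))
  rw [mul_comm]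
  rfl

end LinearForm

/-! ### Closed semialgebraic sets from polynomials with algebraic coefficients -/

section AlgebraicPolynomialFunctions

open ComplexConjugate

variable {d : ℕ}

/-- Functions `ℂ^d → ℂ` whose real and imaginary parts are polynomials with real algebraic
coefficients in the real and imaginary parts of the coordinates. -/
def IsAlgebraicPolynomial (h : (Fin d → ℂ) → ℂ) : Prop :=
  ∃ p q : MvPolynomial (Fin d ⊕ Fin d) (algebraicClosure ℚ ℝ), ∀ z,
    (h z).re = MvPolynomial.aeval (complexEquivReal d z) p ∧
    (h z).im = MvPolynomial.aeval (complexEquivReal d z) q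

theorem isAlgebraic_re {a : ℂ} (ha : IsAlgebraic ℚ a) : IsAlgebraic ℚ a.re := by
  have hc : IsAlgebraic ℚ (conj a) := by
    exact isAlgebraic_iff_isIntegral.mpr
      (ha.isIntegral.map (Complex.conjAe.restrictScalars ℚ).toAlgHom)
  have h2 : IsAlgebraic ℚ ((2 : ℂ)⁻¹) := by
    have := isAlgebraic_algebraMap (R := ℚ) (A := ℂ) (2⁻¹ : ℚ)
    simpa using this
  have h := (ha.add hc).mul h2
  rw [Complex.add_conj, mul_comm (2 : ℝ), Complex.ofReal_mul, Complex.ofReal_ofNat, mul_assoc,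
    mul_inv_cancel₀ two_ne_zero, mul_one] at h
  exact (isAlgebraic_algebraMap_iff (R := ℚ) (S := ℝ) (A := ℂ) Complex.ofReal_injective).mp h

theorem isAlgebraic_I : IsAlgebraic ℚ Complex.I := by
  refine ⟨Polynomial.X ^ 2 + 1, ?_, by simp⟩
  apply Polynomial.Monic.ne_zero
  monicity!

theorem isAlgebraic_im {a : ℂ} (ha : IsAlgebraic ℚ a) : IsAlgebraic ℚ a.im := by
  have h := isAlgebraic_re (ha.mul isAlgebraic_I)
  simp only [Complex.mul_re, Complex.I_re, mul_zero, Complex.I_im, mul_one, zero_sub] at h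
  simpa using h.neg

namespace IsAlgebraicPolynomial

variable {h k : (Fin d → ℂ) → ℂ}

theorem const {a : ℂ} (ha : IsAlgebraic ℚ a) : IsAlgebraicPolynomial fun _ : Fin d → ℂ => a :=
  ⟨MvPolynomial.C ⟨a.re, mem_algebraicClosure_iff.mpr (isAlgebraic_re ha)⟩,
    MvPolynomial.C ⟨a.im, mem_algebraicClosure_iff.mpr (isAlgebraic_im ha)⟩, fun z => by
      rw [MvPolynomial.aeval_C, MvPolynomial.aeval_C]
      exact ⟨rfl, rfl⟩⟩

theorem coordinate (i : Fin d) : IsAlgebraicPolynomial fun z : Fin d → ℂ => z i :=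
  ⟨MvPolynomial.X (Sum.inl i), MvPolynomial.X (Sum.inr i), fun z => by
    rw [MvPolynomial.aeval_X, MvPolynomial.aeval_X]
    exact ⟨rfl, rfl⟩⟩

theorem add (hh : IsAlgebraicPolynomial h) (hk : IsAlgebraicPolynomial k) :
    IsAlgebraicPolynomial fun z => h z + k z := by
  obtain ⟨p, q, hpq⟩ := hh
  obtain ⟨p', q', hpq'⟩ := hk
  exact ⟨p + p', q + q', fun z => by simp [hpq, hpq']⟩

theorem mul (hh : IsAlgebraicPolynomial h) (hk : IsAlgebraicPolynomial k) :
    IsAlgebraicPolynomial fun z => h z * k z := by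
  obtain ⟨p, q, hpq⟩ := hh
  obtain ⟨p', q', hpq'⟩ := hk
  exact ⟨p * p' - q * q', p * q' + q * p', fun z => by simp [hpq, hpq']⟩

theorem star (hh : IsAlgebraicPolynomial h) : IsAlgebraicPolynomial fun z => conj (h z) := by
  obtain ⟨p, q, hpq⟩ := hh
  exact ⟨p, -q, fun z => by simp [hpq]⟩

theorem const_sub {a : ℂ} (ha : IsAlgebraic ℚ a) (hh : IsAlgebraicPolynomial h) :
    IsAlgebraicPolynomial fun z => a - h z := by
  simpa [sub_eq_add_neg] using (const ha).add ((const isAlgebraic_one.neg).mul hh)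

theorem sub_const {a : ℂ} (hh : IsAlgebraicPolynomial h) (ha : IsAlgebraic ℚ a) :
    IsAlgebraicPolynomial fun z => h z - a := by
  simpa [sub_eq_add_neg] using hh.add (const ha.neg)

theorem pow (hh : IsAlgebraicPolynomial h) (n : ℕ) : IsAlgebraicPolynomial fun z => h z ^ n := by
  induction n with
  | zero => simpa using const isAlgebraic_one
  | succ n ih => simpa [pow_succ] using ih.mul hh

theorem sum {ι : Type*} (s : Finset ι) {f : ι → (Fin d → ℂ) → ℂ}
    (hf : ∀ i, IsAlgebraicPolynomial (f i)) : IsAlgebraicPolynomial fun z => ∑ i ∈ s, f i z := by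
  classical
  induction s using Finset.induction_on with
  | empty => simpa using const isAlgebraic_zero
  | insert i s hi ih => simpa [Finset.sum_insert hi] using (hf i).add ih

theorem prod {ι : Type*} (s : Finset ι) {f : ι → (Fin d → ℂ) → ℂ}
    (hf : ∀ i, IsAlgebraicPolynomial (f i)) : IsAlgebraicPolynomial fun z => ∏ i ∈ s, f i z := by
  classical
  induction s using Finset.induction_on with
  | empty => simpa using const isAlgebraic_one
  | insert i s hi ih => simpa [Finset.prod_insert hi] using (hf i).mul ih

theorem continuous (hh : IsAlgebraicPolynomial h) : Continuous h := by
  obtain ⟨p, q, hpq⟩ := hh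
  have hE : Continuous (complexEquivReal d) := by
    refine continuous_pi fun s => ?_
    cases s with
    | inl i => exact Complex.continuous_re.comp (continuous_apply i)
    | inr i => exact Complex.continuous_im.comp (continuous_apply i)
  have hp (p : MvPolynomial (Fin d ⊕ Fin d) (algebraicClosure ℚ ℝ)) :
      Continuous fun z => MvPolynomial.aeval (complexEquivReal d z) p := by
    have h1 : Continuous fun v : Fin d ⊕ Fin d → ℝ => MvPolynomial.aeval v p := by
      simp only [MvPolynomial.aeval_def, MvPolynomial.eval₂_eq]
      fun_prop
    exact h1.comp hE
  have : h = fun z => ((MvPolynomial.aeval (complexEquivReal d z) p : ℝ) : ℂ) +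
      (MvPolynomial.aeval (complexEquivReal d z) q : ℝ) * Complex.I := by
    funext z
    rw [← (hpq z).1, ← (hpq z).2, Complex.re_add_im]
  rw [this]
  exact (Complex.continuous_ofReal.comp (hp p)).add
    ((Complex.continuous_ofReal.comp (hp q)).mul continuous_const)

end IsAlgebraicPolynomial

/-- Topologically closed semialgebraic subsets of `ℂ^d`. -/
def IsClosedSemialgebraic (P : Set (Fin d → ℂ)) : Prop := IsClosed P ∧ IsSemialgebraic P

namespace IsClosedSemialgebraic

theorem inter {P Q : Set (Fin d → ℂ)} (hP : IsClosedSemialgebraic P)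
    (hQ : IsClosedSemialgebraic Q) : IsClosedSemialgebraic (P ∩ Q) := by
  refine ⟨hP.1.inter hQ.1, ?_⟩
  unfold IsSemialgebraic
  rw [Set.image_inter (complexEquivReal d).injective]
  exact hP.2.inter hQ.2

theorem union {P Q : Set (Fin d → ℂ)} (hP : IsClosedSemialgebraic P)
    (hQ : IsClosedSemialgebraic Q) : IsClosedSemialgebraic (P ∪ Q) := by
  refine ⟨hP.1.union hQ.1, ?_⟩
  unfold IsSemialgebraic
  rw [Set.image_union]
  exact hP.2.union hQ.2

theorem univ : IsClosedSemialgebraic (Set.univ : Set (Fin d → ℂ)) := by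
  refine ⟨isClosed_univ, ?_⟩
  unfold IsSemialgebraic
  rw [Set.image_univ, (complexEquivReal d).range_eq_univ]
  exact isRealSemialgebraic_univ

theorem empty : IsClosedSemialgebraic (∅ : Set (Fin d → ℂ)) := by
  refine ⟨isClosed_empty, ?_⟩
  unfold IsSemialgebraic
  rw [Set.image_empty]
  exact isRealSemialgebraic_empty

theorem nonneg_re {h : (Fin d → ℂ) → ℂ} (hh : IsAlgebraicPolynomial h) :
    IsClosedSemialgebraic {z | 0 ≤ (h z).re} := by
  refine ⟨isClosed_le continuous_const (Complex.continuous_re.comp hh.continuous), ?_⟩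
  obtain ⟨p, q, hpq⟩ := hh
  unfold IsSemialgebraic
  convert isRealSemialgebraic_nonneg p
  rw [Equiv.image_eq_preimage_symm]
  ext v
  simp [(hpq _).1]

theorem forall_finset {ι : Type*} (s : Finset ι) {P : ι → Set (Fin d → ℂ)}
    (hP : ∀ i ∈ s, IsClosedSemialgebraic (P i)) : IsClosedSemialgebraic {z | ∀ i ∈ s, z ∈ P i} := by
  classical
  induction s using Finset.induction_on with
  | empty => simpa using univ
  | insert i s hi ih =>
    convert (hP i (Finset.mem_insert_self _ _)).inter
      (ih fun j hj => hP j (Finset.mem_insert_of_mem hj)) using 1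
    ext z
    simp

theorem exists_finset {ι : Type*} (s : Finset ι) {P : ι → Set (Fin d → ℂ)}
    (hP : ∀ i ∈ s, IsClosedSemialgebraic (P i)) : IsClosedSemialgebraic {z | ∃ i ∈ s, z ∈ P i} := by
  classical
  induction s using Finset.induction_on with
  | empty => simpa using empty
  | insert i s hi ih =>
    convert (hP i (Finset.mem_insert_self _ _)).union
      (ih fun j hj => hP j (Finset.mem_insert_of_mem hj)) using 1
    ext z
    simp

theorem eq_zero {h : (Fin d → ℂ) → ℂ} (hh : IsAlgebraicPolynomial h) :
    IsClosedSemialgebraic {z | h z = 0} := by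
  -- The equation is encoded as `-|h|² ≥ 0`.
  convert nonneg_re (IsAlgebraicPolynomial.const_sub isAlgebraic_zero (hh.mul hh.star)) using 3 with z
  rw [Complex.mul_conj, zero_sub, Complex.neg_re, Complex.ofReal_re, neg_nonneg]
  exact ⟨fun h => by simp [h], fun h => Complex.normSq_eq_zero.mp
    (le_antisymm h (Complex.normSq_nonneg _))⟩

theorem singleton {a : Fin d → ℂ} (ha : ∀ i, IsAlgebraic ℚ (a i)) :
    IsClosedSemialgebraic {a} := by
  convert forall_finset Finset.univ fun i _ =>
    eq_zero ((IsAlgebraicPolynomial.coordinate i).sub_const (ha i)) using 1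
  ext z
  simp [sub_eq_zero, funext_iff]

end IsClosedSemialgebraic

end AlgebraicPolynomialFunctions

/-! ### Averages and recurrence for rotations -/

section Kronecker

open ComplexConjugate Filter Topology

/-- The geometric sums stay bounded by `2 / ‖c - 1‖`. -/
theorem tendsto_average_pow_zero {c : ℂ} (hc : ‖c‖ = 1) (h1 : c ≠ 1) :
    Tendsto (fun N : ℕ => (N : ℂ)⁻¹ * ∑ n ∈ Finset.range N, c ^ n) atTop (𝓝 0) := by
  refine Tendsto.zero_mul_isBoundedUnder_le (tendsto_inv_atTop_nhds_zero_nat (𝕜 := ℂ)) ?_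
  refine isBoundedUnder_of ⟨2 / ‖c - 1‖, fun N => ?_⟩
  rw [Function.comp_apply, geom_sum_eq h1, norm_div]
  gcongr
  refine (norm_sub_le _ _).trans ?_
  rw [norm_pow, hc]
  norm_num

variable {ι : Type*} [Fintype ι]

theorem norm_mul_of_norm_eq_one {a z : ι → ℂ} (ha : ∀ i, ‖a i‖ = 1) : ‖a * z‖ = ‖z‖ := by
  have (i : ι) : ‖a i‖₊ = 1 := NNReal.eq (ha i)
  simp [Pi.norm_def, nnnorm_mul, this]

/-- If all monomials in `z` and `conj z` that are invariant under a rotation take the same values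
at two points, then the averages of every continuous function along the two orbits agree
asymptotically. -/
theorem tendsto_average_sub_average {Λ : ι → ℂ} (hΛ : ∀ i, ‖Λ i‖ = 1) {R : ℝ}
    {u w : ℕ → Metric.closedBall (0 : ι → ℂ) R}
    (hu : ∀ n, (u n : ι → ℂ) = Λ ^ n * u 0) (hw : ∀ n, (w n : ι → ℂ) = Λ ^ n * w 0)
    (h : ∀ a b : ι → ℕ, ∏ i, Λ i ^ a i * conj (Λ i) ^ b i = 1 →
      ∏ i, (u 0 : ι → ℂ) i ^ a i * conj ((u 0 : ι → ℂ) i) ^ b i =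
        ∏ i, (w 0 : ι → ℂ) i ^ a i * conj ((w 0 : ι → ℂ) i) ^ b i)
    (f : C(Metric.closedBall (0 : ι → ℂ) R, ℂ)) :
    Tendsto (fun N : ℕ => (N : ℂ)⁻¹ * ∑ n ∈ Finset.range N, (f (u n) - f (w n))) atTop (𝓝 0) := by
  classical
  let X := Metric.closedBall (0 : ι → ℂ) R
  have : CompactSpace X := isCompact_iff_compactSpace.mp (isCompact_closedBall _ _)
  let D (f : C(X, ℂ)) (N : ℕ) : ℂ := (N : ℂ)⁻¹ * ∑ n ∈ Finset.range N, (f (u n) - f (w n))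
  let coord (i : ι) : C(X, ℂ) := ⟨fun z => (z : ι → ℂ) i,
    (continuous_apply i).comp continuous_subtype_val⟩
  have hmonomial (m : C(X, ℂ))
      (hm : m ∈ Submonoid.closure (Set.range coord ∪ star (Set.range coord))) :
      ∃ a b : ι → ℕ, ∀ z : X, m z = ∏ i, (z : ι → ℂ) i ^ a i * conj ((z : ι → ℂ) i) ^ b i := by
    induction hm using Submonoid.closure_induction with
    | mem m hm =>
      rcases hm with ⟨i, rfl⟩ | ⟨i, hi⟩
      · refine ⟨Pi.single i 1, 0, fun z => ?_⟩
        simp [coord, Pi.single_apply, pow_ite]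
      · refine ⟨0, Pi.single i 1, fun z => ?_⟩
        have := congrArg (fun g : C(X, ℂ) => conj (g z)) hi
        simp only [ContinuousMap.star_apply, RCLike.star_def, Complex.conj_conj] at this
        rw [← this]
        simp [coord, Pi.single_apply, pow_ite]
    | one => exact ⟨0, 0, fun z => by simp⟩
    | mul m m' _ _ hm hm' =>
      obtain ⟨a, b, hab⟩ := hm
      obtain ⟨a', b', hab'⟩ := hm'
      refine ⟨a + a', b + b', fun z => ?_⟩
      rw [ContinuousMap.mul_apply, hab, hab', ← Finset.prod_mul_distrib]
      refine Finset.prod_congr rfl fun i _ => ?_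
      simp only [Pi.add_apply, pow_add]
      ring
  -- The functions satisfying the claim form a subspace. It contains the monomials in the
  -- coordinates and their conjugates, hence the star algebra they generate, which is dense by
  -- Stone–Weierstrass.
  let M : Submodule ℂ C(X, ℂ) :=
    { carrier := {f | Tendsto (D f) atTop (𝓝 0)}
      zero_mem' := by simp [D]
      add_mem' := fun {f g} hf hg => by
        have := hf.add hg
        rw [add_zero] at this
        refine this.congr fun N => ?_
        simp only [D, ContinuousMap.add_apply]
        rw [← mul_add, ← Finset.sum_add_distrib]
        congr 1
        exact Finset.sum_congr rfl fun n _ => by ring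
      smul_mem' := fun c f hf => by
        have := hf.const_mul c
        rw [mul_zero] at this
        refine this.congr fun N => ?_
        simp only [D, ContinuousMap.smul_apply, smul_eq_mul]
        rw [mul_left_comm, Finset.mul_sum]
        congr 1
        exact Finset.sum_congr rfl fun n _ => by ring }
  have hM : (Submonoid.closure (Set.range coord ∪ star (Set.range coord)) : Set C(X, ℂ)) ⊆ M := by
    intro m hm
    obtain ⟨a, b, hab⟩ := hmonomial m hm
    set c : ℂ := ∏ i, Λ i ^ a i * conj (Λ i) ^ b i with hc
    have horbit (z : ℕ → X) (hz : ∀ n, (z n : ι → ℂ) = Λ ^ n * z 0) (n : ℕ) :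
        m (z n) = c ^ n * m (z 0) := by
      rw [hab, hab, hc, ← Finset.prod_pow, ← Finset.prod_mul_distrib]
      refine Finset.prod_congr rfl fun i _ => ?_
      rw [hz n]
      simp only [Pi.mul_apply, Pi.pow_apply, map_mul, map_pow]
      ring
    change Tendsto (D m) atTop (𝓝 0)
    have hD (N : ℕ) : D m N =
        ((N : ℂ)⁻¹ * ∑ n ∈ Finset.range N, c ^ n) * (m (u 0) - m (w 0)) := by
      simp only [D]
      rw [mul_assoc, Finset.sum_mul]
      congr 1
      refine Finset.sum_congr rfl fun n _ => ?_
      rw [horbit u hu, horbit w hw, mul_sub]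
    simp_rw [funext hD]
    -- An invariant monomial agrees at the two starting points by hypothesis; any other averages to
    -- zero.
    by_cases hc1 : c = 1
    · have : m (u 0) = m (w 0) := by rw [hab, hab, h a b hc1]
      simp [this]
    · have hcn : ‖c‖ = 1 := by simp [c, norm_prod, hΛ]
      simpa using (tendsto_average_pow_zero hcn hc1).mul_const (m (u 0) - m (w 0))
  have hdense : (StarAlgebra.adjoin ℂ (Set.range coord)).topologicalClosure = ⊤ := by
    refine ContinuousMap.starSubalgebra_topologicalClosure_eq_top_of_separatesPoints _ ?_
    intro z z' hzz'
    obtain ⟨i, hi⟩ : ∃ i, (z : ι → ℂ) i ≠ (z' : ι → ℂ) i := by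
      by_contra! hcon
      exact hzz' (Subtype.ext (funext hcon))
    exact ⟨coord i, ⟨coord i, StarAlgebra.subset_adjoin _ _ ⟨i, rfl⟩, rfl⟩, hi⟩
  have hadjoin (g : C(X, ℂ)) (hg : g ∈ StarAlgebra.adjoin ℂ (Set.range coord)) : g ∈ M := by
    have h1 : g ∈ Subalgebra.toSubmodule (StarAlgebra.adjoin ℂ (Set.range coord)).toSubalgebra := hg
    rw [StarAlgebra.adjoin_eq_span] at h1
    exact Submodule.span_le.mpr hM h1
  -- Uniformity in `N` carries the limit over to uniform limits of functions.
  have hbound (f g : C(X, ℂ)) (N : ℕ) : ‖D f N - D g N‖ ≤ 2 * ‖f - g‖ := by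
    rcases Nat.eq_zero_or_pos N with rfl | hN
    · simp [D]
    have hN' : (0 : ℝ) < N := by exact_mod_cast hN
    simp only [D]
    rw [← mul_sub, ← Finset.sum_sub_distrib, norm_mul, norm_inv, Complex.norm_natCast,
      inv_mul_le_iff₀ hN']
    refine (norm_sum_le _ _).trans ?_
    rw [← nsmul_eq_mul, ← Finset.card_range N, ← Finset.sum_const, Finset.card_range]
    refine Finset.sum_le_sum fun n _ => ?_
    have h1 := (f - g).norm_coe_le_norm (u n)
    have h2 := (f - g).norm_coe_le_norm (w n)
    have h3 : f (u n) - f (w n) - (g (u n) - g (w n)) = (f - g) (u n) - (f - g) (w n) := by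
      simp only [ContinuousMap.sub_apply]
      ring
    rw [h3]
    exact (norm_sub_le _ _).trans (by linarith)
  change Tendsto (D f) atTop (𝓝 0)
  rw [Metric.tendsto_atTop]
  intro ε hε
  have hf : f ∈ (StarAlgebra.adjoin ℂ (Set.range coord)).topologicalClosure := hdense ▸ trivial
  obtain ⟨g, hg, hfg⟩ := Metric.mem_closure_iff.mp hf (ε / 4) (by positivity)
  have hg' : Tendsto (D g) atTop (𝓝 0) := hadjoin g hg
  obtain ⟨N, hN⟩ := Metric.tendsto_atTop.mp hg' (ε / 2) (by positivity)
  refine ⟨N, fun n hn => ?_⟩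
  have h1 := hN n hn
  have h2 := hbound f g n
  rw [dist_eq_norm] at hfg
  rw [dist_zero_right] at h1 ⊢
  have h3 := norm_add_le (D f n - D g n) (D g n)
  rw [sub_add_cancel] at h3
  linarith

/-- A rotation of `ℂ^ι` brings `u` arbitrarily close to `w` infinitely often, if the invariant
monomials do not separate `u` and `w`. -/
theorem frequently_norm_pow_mul_sub_lt {Λ : ι → ℂ} (hΛ : ∀ i, ‖Λ i‖ = 1) (u w : ι → ℂ)
    (h : ∀ a b : ι → ℕ, ∏ i, Λ i ^ a i * conj (Λ i) ^ b i = 1 →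
      ∏ i, u i ^ a i * conj (u i) ^ b i = ∏ i, w i ^ a i * conj (w i) ^ b i)
    {ε : ℝ} (hε : 0 < ε) : ∃ᶠ n : ℕ in atTop, ‖Λ ^ n * u - w‖ < ε := by
  let x : ι → Circle := fun i => ⟨Λ i, mem_sphere_zero_iff_norm.mpr (hΛ i)⟩
  let act (g : ι → Circle) (z : ι → ℂ) : ι → ℂ := fun i => (g i : ℂ) * z i
  have hact_norm (g : ι → Circle) (z : ι → ℂ) : ‖act g z‖ = ‖z‖ :=
    norm_mul_of_norm_eq_one (a := fun i => (g i : ℂ)) fun i => Circle.norm_coe _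
  have hact_mul (g g' : ι → Circle) (z : ι → ℂ) : act (g * g') z = act g (act g' z) := by
    funext i
    simp [act, mul_assoc]
  have hact_sub (g : ι → Circle) (z z' : ι → ℂ) : act g z - act g z' = act g (z - z') := by
    funext i
    simp [act, mul_sub]
  have hact_pow (n : ℕ) (z : ι → ℂ) : Λ ^ n * z = act (x ^ n) z := by
    funext i
    change Λ i ^ n * z i = (((x i) ^ n : Circle) : ℂ) * z i
    rw [Circle.coe_pow]
  -- Integer exponents make `O` stable under the inverse rotation, so the distance to `O` cannot
  -- drop along an orbit. It is zero along the orbit of `u`; equality of averages forces it to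
  -- vanish at `w`.
  let O : Set (ι → ℂ) := Set.range fun m : ℤ => act (x ^ m) u
  have hO : O.Nonempty := Set.range_nonempty _
  let R : ℝ := max ‖u‖ ‖w‖
  let ou (n : ℕ) : Metric.closedBall (0 : ι → ℂ) R :=
    ⟨Λ ^ n * u, by
      rw [mem_closedBall_zero_iff, hact_pow, hact_norm]
      exact le_max_left _ _⟩
  let ow (n : ℕ) : Metric.closedBall (0 : ι → ℂ) R :=
    ⟨Λ ^ n * w, by
      rw [mem_closedBall_zero_iff, hact_pow, hact_norm]
      exact le_max_right _ _⟩
  have havg := tendsto_average_sub_average hΛ (u := ou) (w := ow) (fun n => by simp [ou])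
    (fun n => by simp [ow]) (by simpa [ou, ow] using h)
    ⟨fun z => (Metric.infDist (z : ι → ℂ) O : ℂ),
      Complex.continuous_ofReal.comp ((Metric.continuous_infDist_pt O).comp continuous_subtype_val)⟩
  have hle (n : ℕ) (z : ι → ℂ) : Metric.infDist z O ≤ Metric.infDist (Λ ^ n * z) O := by
    refine (Metric.le_infDist hO).mpr ?_
    rintro _ ⟨m, rfl⟩
    have hmem : act (x ^ (m - n)) u ∈ O := ⟨m - n, rfl⟩
    refine (Metric.infDist_le_dist_of_mem hmem).trans_eq ?_
    rw [dist_eq_norm, dist_eq_norm, hact_pow, ← hact_norm (x ^ n), ← hact_sub, ← hact_mul]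
    rw [← zpow_natCast, ← zpow_add, add_sub_cancel]
  have hu0 (n : ℕ) : Metric.infDist (Λ ^ n * u) O = 0 :=
    Metric.infDist_zero_of_mem ⟨n, by rw [hact_pow]; simp⟩
  have hw0 : Metric.infDist w O = 0 := by
    refine le_antisymm ?_ Metric.infDist_nonneg
    have hlim := havg.norm
    rw [norm_zero] at hlim
    refine ge_of_tendsto hlim ((eventually_ge_atTop 1).mono fun N hN => ?_)
    have hN' : (0 : ℝ) < N := by exact_mod_cast hN
    have hsum : ∑ n ∈ Finset.range N, (((Metric.infDist (Λ ^ n * u) O : ℝ) : ℂ) -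
        (Metric.infDist (Λ ^ n * w) O : ℝ)) =
        ((-∑ n ∈ Finset.range N, Metric.infDist (Λ ^ n * w) O : ℝ) : ℂ) := by
      simp [hu0]
    simp only [ou, ow, ContinuousMap.coe_mk]
    rw [hsum, norm_mul, norm_inv, Complex.norm_natCast, Complex.norm_real, norm_neg, Real.norm_eq_abs,
      abs_of_nonneg (Finset.sum_nonneg fun n _ => Metric.infDist_nonneg), le_inv_mul_iff₀ hN',
      ← nsmul_eq_mul, ← Finset.card_range N, ← Finset.sum_const, Finset.card_range]
    exact Finset.sum_le_sum fun n _ => hle n w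
  obtain ⟨_, ⟨m, rfl⟩, hm⟩ := (Metric.infDist_lt_iff hO).mp (hw0.trans_lt (half_pos hε))
  -- The exponent `m` may be negative; in the compact torus, `x ^ m` is still a cluster point of the
  -- positive powers of `x`.
  have hcluster := mapClusterPt_self_zpow_atTop_pow x m
  have hnhds : {g : ι → Circle | ‖act g u - act (x ^ m) u‖ < ε / 2} ∈ 𝓝 (x ^ m) := by
    have hcont : Continuous fun g : ι → Circle => ‖act g u - act (x ^ m) u‖ := by
      simp only [act]
      fun_prop
    exact (isOpen_lt hcont continuous_const).mem_nhds (by simpa using half_pos hε)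
  refine (hcluster.frequently hnhds).mono fun n hn => ?_
  rw [hact_pow]
  rw [dist_comm, dist_eq_norm] at hm
  have := norm_add_le (act (x ^ n) u - act (x ^ m) u) (act (x ^ m) u - w)
  rw [sub_add_sub_cancel] at this
  have h2 : ‖act (x ^ n) u - act (x ^ m) u‖ < ε / 2 := hn
  linarith

end Kronecker

open ComplexConjugate Filter Topology

/-! ### Contracting recurrences -/

section Recurrence

theorem tendsto_zero_of_recurrence {a b : ℕ → ℂ} {c : ℂ} (hc : ‖c‖ < 1)
    (h : ∀ n, a (n + 1) = c * a n + b n) (hb : Tendsto b atTop (𝓝 0)) :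
    Tendsto a atTop (𝓝 0) := by
  rw [Metric.tendsto_atTop] at hb ⊢
  intro ε hε
  have hc' : 0 < 1 - ‖c‖ := by linarith
  -- With this bound on `b`, `ε / 2` is the fixed point of the majorizing recurrence.
  obtain ⟨N, hN⟩ := hb (ε / 2 * (1 - ‖c‖)) (by positivity)
  simp only [dist_zero_right] at hN ⊢
  have hstep (m : ℕ) : ‖a (N + m)‖ ≤ ‖c‖ ^ m * ‖a N‖ + ε / 2 := by
    induction m with
    | zero => simpa using (half_pos hε).le
    | succ m ih =>
      rw [← add_assoc, h, pow_succ]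
      refine (norm_add_le _ _).trans ?_
      rw [norm_mul]
      have h1 := (hN (N + m) (Nat.le_add_right _ _)).le
      have h2 := mul_le_mul_of_nonneg_left ih (norm_nonneg c)
      nlinarith
  have hpow : Tendsto (fun m : ℕ => ‖c‖ ^ m * ‖a N‖) atTop (𝓝 0) := by
    simpa using (tendsto_pow_atTop_nhds_zero_of_lt_one (norm_nonneg c) hc).mul_const ‖a N‖
  obtain ⟨M, hM⟩ := (hpow.eventually (gt_mem_nhds (half_pos hε))).exists_forall_of_atTop
  refine ⟨N + M, fun n hn => ?_⟩
  obtain ⟨m, rfl⟩ := Nat.exists_eq_add_of_le (le_of_add_le_left hn)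
  have h1 := hstep m
  have h2 := hM m (by omega)
  linarith

end Recurrence

/-! ### Linear functionals with algebraic coefficients -/

section Functionals

variable {d : ℕ}

/-- The field of complex algebraic numbers. -/
noncomputable abbrev QBar : IntermediateField ℚ ℂ := algebraicClosure ℚ ℂ

theorem QBar.isAlgebraic (a : QBar) : IsAlgebraic ℚ (a : ℂ) := mem_algebraicClosure_iff.mp a.2

instance QBar.isAlgClosed : IsAlgClosed QBar :=
  (algebraicClosure.isAlgClosure ℚ ℂ).isAlgClosed

/-- The value at `z` of the linear functional with coefficients `f`. -/
noncomputable def pairing (f : Fin d → QBar) (z : Fin d → ℂ) : ℂ := ∑ i, (f i : ℂ) * z i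

theorem pairing_add (f g : Fin d → QBar) (z : Fin d → ℂ) :
    pairing (f + g) z = pairing f z + pairing g z := by
  simp [pairing, add_mul, Finset.sum_add_distrib]

theorem pairing_smul (c : QBar) (f : Fin d → QBar) (z : Fin d → ℂ) :
    pairing (c • f) z = c * pairing f z := by
  simp [pairing, Finset.mul_sum, mul_assoc]

theorem pairing_zero (z : Fin d → ℂ) : pairing 0 z = 0 := by
  simp [pairing]

theorem isAlgebraicPolynomial_pairing (f : Fin d → QBar) : IsAlgebraicPolynomial (pairing f) :=
  IsAlgebraicPolynomial.sum _ fun i =>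
    (IsAlgebraicPolynomial.const (QBar.isAlgebraic (f i))).mul (.coordinate i)

theorem conj_mem_QBar {a : ℂ} (ha : a ∈ QBar) : conj a ∈ QBar :=
  mem_algebraicClosure_iff.mpr (isAlgebraic_iff_isIntegral.mpr
    ((mem_algebraicClosure_iff.mp ha).isIntegral.map (Complex.conjAe.restrictScalars ℚ).toAlgHom))

end Functionals

/-! ### The dual action and the span of the orbit -/

namespace OrbitInstance

variable {d : ℕ} (l : OrbitInstance d)

/-- The transposed action of `A` on linear functionals with algebraic coefficients. -/
noncomputable def dualAction : Module.End QBar (Fin d → QBar) :=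
  Matrix.vecMulLinear (Matrix.of fun i j => ⟨l.A i j, mem_algebraicClosure_iff.mpr (l.algebraic_A i j)⟩)

theorem pairing_dualAction (f : Fin d → QBar) (z : Fin d → ℂ) :
    pairing (l.dualAction f) z = pairing f (l.A *ᵥ z) := by
  simp only [pairing, dualAction, Matrix.vecMulLinear_apply, Matrix.vecMul, Matrix.mulVec,
    dotProduct, Matrix.of_apply, Finset.mul_sum, Finset.sum_mul, AddSubmonoidClass.coe_finsetSum,
    MulMemClass.coe_mul, mul_assoc]
  exact Finset.sum_comm

/-- The iterates of the source. -/
noncomputable def iterate (n : ℕ) : Fin d → ℂ := (l.A ^ n) *ᵥ l.x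

theorem iterate_zero : l.iterate 0 = l.x := by simp [iterate]

theorem iterate_succ (n : ℕ) : l.iterate (n + 1) = l.A *ᵥ l.iterate n := by
  simp [iterate, pow_succ']

theorem isAlgebraic_iterate (n : ℕ) (i : Fin d) : IsAlgebraic ℚ (l.iterate n i) := by
  rw [← mem_algebraicClosure_iff]
  induction n generalizing i with
  | zero =>
    rw [iterate_zero]
    exact mem_algebraicClosure_iff.mpr (l.algebraic_x i)
  | succ n ih =>
    rw [iterate_succ, Matrix.mulVec]
    exact sum_mem fun j _ => mul_mem (mem_algebraicClosure_iff.mpr (l.algebraic_A i j)) (ih j)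

/-- The functionals vanishing on the orbit. -/
noncomputable def annihilator : Submodule QBar (Fin d → QBar) where
  carrier := {f | ∀ n, pairing f (l.iterate n) = 0}
  zero_mem' n := pairing_zero _
  add_mem' hf hg n := by rw [pairing_add, hf n, hg n, add_zero]
  smul_mem' c f hf n := by rw [pairing_smul, hf n, mul_zero]

/-- The complex span of the orbit, as a common zero set of functionals. -/
def orbitSpan : Set (Fin d → ℂ) := {z | ∀ f ∈ l.annihilator, pairing f z = 0}

theorem dualAction_mem_annihilator {f : Fin d → QBar} (hf : f ∈ l.annihilator) :
    l.dualAction f ∈ l.annihilator := fun n => by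
  rw [pairing_dualAction, ← iterate_succ]
  exact hf (n + 1)

theorem iterate_mem_orbitSpan (n : ℕ) : l.iterate n ∈ l.orbitSpan := fun _ hf => hf n

theorem mulVec_mem_orbitSpan {z : Fin d → ℂ} (hz : z ∈ l.orbitSpan) :
    l.A *ᵥ z ∈ l.orbitSpan := fun f hf => by
  rw [← pairing_dualAction]
  exact hz _ (l.dualAction_mem_annihilator hf)

theorem isClosedSemialgebraic_orbitSpan : IsClosedSemialgebraic l.orbitSpan := by
  -- Finitely many generators of the annihilator already cut out the span.
  obtain ⟨s, hs⟩ := IsNoetherian.noetherian l.annihilator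
  convert IsClosedSemialgebraic.forall_finset s fun f _ =>
    IsClosedSemialgebraic.eq_zero (isAlgebraicPolynomial_pairing f) using 1
  ext z
  refine ⟨fun hz f hf => hz f (hs ▸ Submodule.subset_span hf), fun hz f hf => ?_⟩
  rw [← hs] at hf
  induction hf using Submodule.span_induction with
  | mem f hf => exact hz f hf
  | zero => exact pairing_zero _
  | add f g _ _ hf hg => rw [pairing_add, hf, hg, add_zero]
  | smul c f _ hf => rw [pairing_smul, hf, mul_zero]

/-- On the span of the orbit, an eigenvector modulo the annihilator acts as an eigenvector. -/
theorem pairing_mulVec_of_sub_mem {f : Fin d → QBar} {c : QBar}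
    (hf : l.dualAction f - c • f ∈ l.annihilator) {z : Fin d → ℂ} (hz : z ∈ l.orbitSpan) :
    pairing f (l.A *ᵥ z) = c * pairing f z := by
  have h := hz _ hf
  rw [sub_eq_add_neg, ← neg_one_smul QBar, pairing_add, pairing_smul, pairing_smul,
    pairing_dualAction] at h
  push_cast at h
  linear_combination h

theorem pairing_iterate_of_sub_mem {f : Fin d → QBar} {c : QBar}
    (hf : l.dualAction f - c • f ∈ l.annihilator) (n : ℕ) :
    pairing f (l.iterate n) = (c : ℂ) ^ n * pairing f l.x := by
  induction n with
  | zero => simp [iterate_zero]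
  | succ n ih =>
    rw [iterate_succ, l.pairing_mulVec_of_sub_mem hf (l.iterate_mem_orbitSpan n), ih, pow_succ']
    ring

theorem pairing_source_ne_zero {f : Fin d → QBar} {c : QBar}
    (hf : l.dualAction f - c • f ∈ l.annihilator) (hf' : f ∉ l.annihilator) :
    pairing f l.x ≠ 0 := fun h0 => hf' fun n => by
  rw [l.pairing_iterate_of_sub_mem hf, h0, mul_zero]

/-! ### Invariants from eigenvalues, Jordan blocks and monomials -/

/-- An invariant can be built from an invariant set that the orbit enters eventually. -/
theorem exists_invariant_of_eventual (hy : l.y ∉ closure l.orbit) {Q : Set (Fin d → ℂ)}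
    (hQ : IsClosedSemialgebraic Q) (hstable : ∀ z ∈ Q, l.A *ᵥ z ∈ Q) (N : ℕ)
    (hN : l.iterate N ∈ Q) (hyQ : l.y ∉ Q) :
    ∃ P : Set (Fin d → ℂ), IsClosed P ∧ IsSemialgebraic P ∧ l.IsInvariant P := by
  have hP : IsClosedSemialgebraic ({z | ∃ n ∈ Finset.range N, z ∈ ({l.iterate n} : Set _)} ∪ Q) :=
    (IsClosedSemialgebraic.exists_finset _ fun n _ =>
      .singleton (l.isAlgebraic_iterate n)).union hQ
  refine ⟨_, hP.1, hP.2, ?_, ?_, ?_⟩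
  · rintro _ ⟨z, ⟨n, hn, rfl⟩ | hz, rfl⟩
    · simp only [← iterate_succ]
      rcases (Nat.succ_le_of_lt (Finset.mem_range.mp hn)).eq_or_lt with h | h
      · right
        rw [Nat.succ_eq_add_one] at h
        rwa [h]
      · exact Or.inl ⟨n + 1, Finset.mem_range.mpr h, rfl⟩
    · exact Or.inr (hstable z hz)
  · rcases Nat.eq_zero_or_pos N with rfl | h
    · right
      rwa [← iterate_zero]
    · exact Or.inl ⟨0, Finset.mem_range.mpr h, l.iterate_zero.symm⟩
  · rintro (⟨n, -, h⟩ | h)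
    · exact hy (subset_closure ⟨n, Eq.symm h⟩)
    · exact hyQ h

/-- On the span, `|f|²` is multiplied by `|c|² > 1`, so the region `|f|² ≥ C` is stable and the
orbit enters it; `C` is chosen above the value at `y`. -/
theorem exists_invariant_of_one_lt_norm (hy : l.y ∉ closure l.orbit) {f : Fin d → QBar} {c : QBar}
    (hf : l.dualAction f - c • f ∈ l.annihilator) (hf' : f ∉ l.annihilator)
    (hc : 1 < ‖(c : ℂ)‖) :
    ∃ P : Set (Fin d → ℂ), IsClosed P ∧ IsSemialgebraic P ∧ l.IsInvariant P := by
  obtain ⟨C, hC⟩ := exists_nat_gt (Complex.normSq (pairing f l.y))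
  have hnormSq (z : Fin d → ℂ) : (pairing f z * conj (pairing f z) - (C : ℂ)).re =
      Complex.normSq (pairing f z) - C := by simp [Complex.mul_conj]
  have hQ := l.isClosedSemialgebraic_orbitSpan.inter (IsClosedSemialgebraic.nonneg_re
    (((isAlgebraicPolynomial_pairing f).mul (isAlgebraicPolynomial_pairing f).star).sub_const
      (isAlgebraic_natCast C)))
  have hgrow : Tendsto (fun n : ℕ => Complex.normSq (pairing f (l.iterate n))) atTop atTop := by
    have h0 : 0 < Complex.normSq (pairing f l.x) :=
      Complex.normSq_pos.mpr (l.pairing_source_ne_zero hf hf')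
    have h1 : 1 < Complex.normSq c := by
      rw [Complex.normSq_eq_norm_sq]
      exact one_lt_pow₀ hc two_ne_zero
    refine ((tendsto_pow_atTop_atTop_of_one_lt h1).atTop_mul_const h0).congr fun n => ?_
    rw [l.pairing_iterate_of_sub_mem hf, map_mul, map_pow]
  obtain ⟨N, hN⟩ := (hgrow.eventually_ge_atTop (C : ℝ)).exists
  refine l.exists_invariant_of_eventual hy hQ ?_ N ⟨l.iterate_mem_orbitSpan N, ?_⟩ ?_
  · rintro z ⟨hz, hz'⟩
    refine ⟨l.mulVec_mem_orbitSpan hz, ?_⟩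
    rw [Set.mem_ofPred_eq, hnormSq] at hz' ⊢
    rw [l.pairing_mulVec_of_sub_mem hf hz, map_mul]
    have h1 : 1 ≤ Complex.normSq c := by
      rw [Complex.normSq_eq_norm_sq]
      exact one_le_pow₀ hc.le
    have := Complex.normSq_nonneg (pairing f z)
    nlinarith
  · rw [Set.mem_ofPred_eq, hnormSq]
    linarith
  · rintro ⟨-, h⟩
    rw [Set.mem_ofPred_eq, hnormSq] at h
    linarith

/-- On the span, `A` sends `(g, f)` to `(c g + f, c f)`. With `|c| = 1`, the quantity `c g conj f`
gains exactly `|f|²`, a positive constant along the orbit, so its real part grows linearly there. -/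
theorem exists_invariant_of_jordan_block (hy : l.y ∉ closure l.orbit) {f g : Fin d → QBar}
    {c : QBar} (hg : l.dualAction g - c • g = f)
    (hf : l.dualAction f - c • f ∈ l.annihilator) (hf' : f ∉ l.annihilator)
    (hc : ‖(c : ℂ)‖ = 1) :
    ∃ P : Set (Fin d → ℂ), IsClosed P ∧ IsSemialgebraic P ∧ l.IsInvariant P := by
  let w (z : Fin d → ℂ) : ℂ := c * (pairing g z * conj (pairing f z))
  have hw : IsAlgebraicPolynomial w := (IsAlgebraicPolynomial.const (QBar.isAlgebraic c)).mul
    ((isAlgebraicPolynomial_pairing g).mul (isAlgebraicPolynomial_pairing f).star)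
  have hcc : (c : ℂ) * conj (c : ℂ) = 1 := by
    rw [Complex.mul_conj, Complex.normSq_eq_norm_sq, hc]
    simp
  have hwA (z : Fin d → ℂ) (hz : z ∈ l.orbitSpan) :
      w (l.A *ᵥ z) = w z + Complex.normSq (pairing f z) := by
    have hgz : pairing g (l.A *ᵥ z) = c * pairing g z + pairing f z := by
      rw [← pairing_dualAction, ← pairing_smul, ← pairing_add, ← hg, add_sub_cancel]
    simp only [w]
    rw [hgz, l.pairing_mulVec_of_sub_mem hf hz, map_mul, ← Complex.mul_conj]
    linear_combination (c * pairing g z * conj (pairing f z) +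
      pairing f z * conj (pairing f z)) * hcc
  have hwiter (n : ℕ) :
      (w (l.iterate n)).re = (w l.x).re + n * Complex.normSq (pairing f l.x) := by
    induction n with
    | zero => simp [iterate_zero]
    | succ n ih =>
      rw [iterate_succ, hwA _ (l.iterate_mem_orbitSpan n), Complex.add_re, ih, Complex.ofReal_re,
        l.pairing_iterate_of_sub_mem hf, map_mul, map_pow, Complex.normSq_eq_norm_sq (c : ℂ), hc]
      push_cast
      ring
  obtain ⟨C, hC⟩ := exists_nat_gt (w l.y).re
  have hQ := l.isClosedSemialgebraic_orbitSpan.inter (IsClosedSemialgebraic.nonneg_re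
    (hw.sub_const (isAlgebraic_natCast C)))
  have h0 : 0 < Complex.normSq (pairing f l.x) :=
    Complex.normSq_pos.mpr (l.pairing_source_ne_zero hf hf')
  have hgrow : Tendsto (fun n : ℕ => (w (l.iterate n)).re) atTop atTop := by
    simp_rw [hwiter]
    exact tendsto_atTop_add_const_left _ _ (tendsto_natCast_atTop_atTop.atTop_mul_const h0)
  obtain ⟨N, hN⟩ := (hgrow.eventually_ge_atTop (C : ℝ)).exists
  refine l.exists_invariant_of_eventual hy hQ ?_ N ⟨l.iterate_mem_orbitSpan N, ?_⟩ ?_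
  · rintro z ⟨hz, hz'⟩
    refine ⟨l.mulVec_mem_orbitSpan hz, ?_⟩
    rw [Set.mem_ofPred_eq, Complex.sub_re] at hz' ⊢
    rw [hwA z hz, Complex.add_re, Complex.ofReal_re]
    have := Complex.normSq_nonneg (pairing f z)
    linarith
  · simpa using hN
  · rintro ⟨-, h⟩
    rw [Set.mem_ofPred_eq, Complex.sub_re, Complex.natCast_re] at h
    linarith

theorem pairing_mulVec_eq (f : Fin d → QBar) (c : QBar) (z : Fin d → ℂ) :
    pairing f (l.A *ᵥ z) = c * pairing f z + pairing ((l.dualAction - c • 1) f) z := by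
  rw [← pairing_dualAction, ← pairing_smul, ← pairing_add]
  simp

/-- Each vector of the Jordan chain satisfies a contracting recurrence driven by the next, which
tends to zero by induction. -/
theorem tendsto_pairing_iterate_zero {c : QBar} (hc : ‖(c : ℂ)‖ < 1) {k : ℕ} {f : Fin d → QBar}
    (hf : ((l.dualAction - c • 1) ^ k) f = 0) :
    Tendsto (fun n => pairing f (l.iterate n)) atTop (𝓝 0) := by
  induction k generalizing f with
  | zero =>
    have : f = 0 := by simpa using hf
    simp [this, pairing_zero]
  | succ k ih =>
    rw [pow_succ, Module.End.mul_apply] at hf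
    exact tendsto_zero_of_recurrence hc
      (fun n => by rw [iterate_succ, l.pairing_mulVec_eq f c]) (ih hf)

theorem exists_invariant_of_norm_lt_one (hy : l.y ∉ closure l.orbit) {f : Fin d → QBar}
    {c : QBar} {k : ℕ} (hf : ((l.dualAction - c • 1) ^ k) f = 0) (hc : ‖(c : ℂ)‖ < 1)
    (hfy : pairing f l.y ≠ 0) :
    ∃ P : Set (Fin d → ℂ), IsClosed P ∧ IsSemialgebraic P ∧ l.IsInvariant P := by
  let F (j : ℕ) : Fin d → QBar := ((l.dualAction - c • 1) ^ j) f
  have hF (j : ℕ) (z : Fin d → ℂ) :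
      pairing (F j) (l.A *ᵥ z) = c * pairing (F j) z + pairing (F (j + 1)) z := by
    rw [l.pairing_mulVec_eq (F j) c]
    simp only [F, pow_succ', Module.End.mul_apply]
  have hFk (j : ℕ) (hj : k ≤ j) : F j = 0 := by
    obtain ⟨m, rfl⟩ := Nat.exists_eq_add_of_le' hj
    simp only [F, pow_add, Module.End.mul_apply, hf, map_zero]
  -- The conditions `‖F j‖ ≤ ε q ^ j` are jointly stable because `‖c‖ + q ≤ 1`; `ε < ‖f(y)‖`
  -- excludes `y` at `j = 0`. Rational values keep the set semialgebraic.
  obtain ⟨q, hq0, hq1⟩ := exists_rat_btwn (sub_pos.mpr hc)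
  obtain ⟨ε, hε0, hε1⟩ := exists_rat_btwn (norm_pos_iff.mpr hfy)
  have hmem (j : ℕ) (z : Fin d → ℂ) :
      0 ≤ ((((ε * q ^ j) ^ 2 : ℚ) : ℂ) - pairing (F j) z * conj (pairing (F j) z)).re ↔
        ‖pairing (F j) z‖ ≤ ε * q ^ j := by
    rw [Complex.mul_conj, Complex.sub_re, Complex.ofReal_re, Complex.normSq_eq_norm_sq,
      Complex.ratCast_re, sub_nonneg]
    push_cast
    exact pow_le_pow_iff_left₀ (norm_nonneg _) (by positivity) two_ne_zero
  have hQ := IsClosedSemialgebraic.forall_finset (Finset.range (k + 1)) fun j _ =>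
    IsClosedSemialgebraic.nonneg_re (IsAlgebraicPolynomial.const_sub
      (isAlgebraic_algebraMap (R := ℚ) (A := ℂ) ((ε * q ^ j) ^ 2))
      ((isAlgebraicPolynomial_pairing (F j)).mul (isAlgebraicPolynomial_pairing (F j)).star))
  simp only [eq_ratCast, Set.mem_ofPred_eq, hmem] at hQ
  have hev : ∀ᶠ n in atTop, ∀ j ∈ Finset.range (k + 1), ‖pairing (F j) (l.iterate n)‖ ≤ ε * q ^ j := by
    rw [eventually_all_finset]
    intro j _
    have hj : ((l.dualAction - c • 1) ^ k) (F j) = 0 := by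
      simp only [F]
      rw [← Module.End.mul_apply, ← pow_add, add_comm, pow_add, Module.End.mul_apply, hf, map_zero]
    have := (l.tendsto_pairing_iterate_zero hc hj).norm
    rw [norm_zero] at this
    exact (this.eventually (gt_mem_nhds (by positivity : (0 : ℝ) < ε * q ^ j))).mono
      fun n hn => le_of_lt hn
  obtain ⟨N, hN⟩ := hev.exists
  refine l.exists_invariant_of_eventual hy hQ (fun z hz j hj => ?_) N hN fun h => ?_
  · have h1 := hz j hj
    have h2 : ‖pairing (F (j + 1)) z‖ ≤ ε * q ^ (j + 1) := by
      by_cases hjk : j + 1 ∈ Finset.range (k + 1)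
      · exact hz _ hjk
      · rw [hFk (j + 1) (by simp at hjk; omega), pairing_zero, norm_zero]
        positivity
    rw [hF]
    refine (norm_add_le _ _).trans ?_
    rw [norm_mul]
    have h3 : 0 ≤ (ε : ℝ) * q ^ j := by positivity
    have h4 := mul_le_mul_of_nonneg_left h1 (norm_nonneg (c : ℂ))
    rw [pow_succ] at h2
    nlinarith
  · have := h 0 (by simp)
    simp only [F, pow_zero, mul_one, Module.End.one_apply] at this
    linarith

/-- On the span the monomial is constant under `A`, so its level set through `x` is stable; the
level is algebraic because `x` is. -/
theorem exists_invariant_of_monomial (hy : l.y ∉ closure l.orbit) {ι : Type*} [Fintype ι]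
    {f : ι → Fin d → QBar} {c : ι → QBar}
    (hf : ∀ i, l.dualAction (f i) - c i • f i ∈ l.annihilator) {a b : ι → ℕ}
    (hab : ∏ i, (c i : ℂ) ^ a i * conj (c i : ℂ) ^ b i = 1)
    (hne : ∏ i, pairing (f i) l.x ^ a i * conj (pairing (f i) l.x) ^ b i ≠
      ∏ i, pairing (f i) l.y ^ a i * conj (pairing (f i) l.y) ^ b i) :
    ∃ P : Set (Fin d → ℂ), IsClosed P ∧ IsSemialgebraic P ∧ l.IsInvariant P := by
  let h (z : Fin d → ℂ) : ℂ := ∏ i, pairing (f i) z ^ a i * conj (pairing (f i) z) ^ b i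
  have hh : IsAlgebraicPolynomial h := IsAlgebraicPolynomial.prod _ fun i =>
    ((isAlgebraicPolynomial_pairing (f i)).pow (a i)).mul
      ((isAlgebraicPolynomial_pairing (f i)).star.pow (b i))
  have hx : IsAlgebraic ℚ (h l.x) := by
    have hfx (i : ι) : pairing (f i) l.x ∈ QBar :=
      sum_mem fun j _ => mul_mem (f i j).2 (mem_algebraicClosure_iff.mpr (l.algebraic_x j))
    exact mem_algebraicClosure_iff.mp (prod_mem fun i _ =>
      mul_mem (pow_mem (hfx i) _) (pow_mem (conj_mem_QBar (hfx i)) _))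
  have hQ := l.isClosedSemialgebraic_orbitSpan.inter
    (IsClosedSemialgebraic.eq_zero (hh.sub_const hx))
  refine l.exists_invariant_of_eventual hy hQ ?_ 0 ⟨l.iterate_mem_orbitSpan 0, ?_⟩ ?_
  · rintro z ⟨hz, hz'⟩
    refine ⟨l.mulVec_mem_orbitSpan hz, ?_⟩
    have : h (l.A *ᵥ z) = h z := by
      rw [← one_mul (h z), ← hab]
      simp only [h]
      rw [← Finset.prod_mul_distrib]
      refine Finset.prod_congr rfl fun i _ => ?_
      rw [l.pairing_mulVec_of_sub_mem (hf i) hz, map_mul]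
      ring
    rwa [Set.mem_ofPred_eq, this]
  · simp [iterate_zero]
  · rintro ⟨-, heq⟩
    exact hne (sub_eq_zero.mp heq).symm

/-! ### Assembling the cases -/

/-- The space of functionals is spanned by finitely many generalized eigenvectors. -/
theorem exists_span_generalizedEigenvectors :
    ∃ (s : Finset (Fin d → QBar)) (c : s → QBar),
      (∀ i, ∃ k : ℕ, ((l.dualAction - c i • 1) ^ k) (i : Fin d → QBar) = 0) ∧
      ∀ e : Fin d → QBar, ∃ r : s → QBar, ∑ i, r i • (i : Fin d → QBar) = e := by
  have htop := Module.End.iSup_maxGenEigenspace_eq_top l.dualAction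
  rw [Submodule.iSup_eq_span] at htop
  have hfg : (Submodule.span QBar (⋃ c, (l.dualAction.maxGenEigenspace c : Set (Fin d → QBar)))).FG := by
    rw [htop]
    exact Module.Finite.fg_top
  obtain ⟨s, hs, hspan⟩ := (Submodule.fg_span_iff_fg_span_finset_subset _).mp hfg
  have hex (i : s) : ∃ c : QBar, ∃ k : ℕ,
      ((l.dualAction - c • 1) ^ k) (i : Fin d → QBar) = 0 := by
    obtain ⟨c, hc⟩ := Set.mem_iUnion.mp (hs i.2)
    exact ⟨c, Module.End.mem_maxGenEigenspace _ _ _ |>.mp hc⟩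
  choose c hc using hex
  refine ⟨s, c, hc, fun e => ?_⟩
  have he : e ∈ Submodule.span QBar (Set.range (Subtype.val : s → Fin d → QBar)) := by
    rw [Subtype.range_coe_subtype]
    change e ∈ Submodule.span QBar (s : Set (Fin d → QBar))
    rw [← hspan, htop]
    trivial
  exact (Submodule.mem_span_range_iff_exists_fun QBar).mp he

/-- The last vector of a chain of generalized eigenvectors outside of the annihilator. -/
theorem exists_last_notMem {f : Fin d → QBar} {c : QBar} {k : ℕ}
    (hf : ((l.dualAction - c • 1) ^ k) f = 0) (hf' : f ∉ l.annihilator) :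
    ∃ j : ℕ, ((l.dualAction - c • 1) ^ j) f ∉ l.annihilator ∧
      ((l.dualAction - c • 1) ^ (j + 1)) f ∈ l.annihilator := by
  by_contra! hcon
  have (j : ℕ) : ((l.dualAction - c • 1) ^ j) f ∉ l.annihilator := by
    induction j with
    | zero => simpa using hf'
    | succ j ih => exact hcon j ih
  exact this k (hf ▸ zero_mem _)

/-- As `s` spans all functionals, a point is a continuous function of its values under `s`. -/
theorem mem_closure_orbit_of_frequently {s : Finset (Fin d → QBar)}
    (hs : ∀ e : Fin d → QBar, ∃ r : s → QBar, ∑ i, r i • (i : Fin d → QBar) = e)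
    (h : ∀ ε > 0, ∃ᶠ n in atTop, ∀ i : s, ‖pairing i (l.iterate n) - pairing i l.y‖ < ε) :
    l.y ∈ closure l.orbit := by
  choose r hr using fun k : Fin d => hs (Pi.single k 1)
  let L (v : s → ℂ) : Fin d → ℂ := fun k => ∑ i, (r k i : ℂ) * v i
  have hL : Continuous L := by fun_prop
  have hLz (z : Fin d → ℂ) : L (fun i => pairing i z) = z := by
    funext k
    have hsum (t : Finset s) : pairing (∑ i ∈ t, r k i • (i : Fin d → QBar)) z =
        ∑ i ∈ t, (r k i : ℂ) * pairing i z := by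
      classical
      induction t using Finset.induction_on with
      | empty => simp [pairing_zero]
      | insert i t hi ih => rw [Finset.sum_insert hi, Finset.sum_insert hi, pairing_add,
          pairing_smul, ih]
    simp only [L]
    rw [← hsum, hr]
    rw [pairing, Finset.sum_eq_single k]
    · simp
    · intro j _ hj
      simp [hj]
    · simp
  rw [Metric.mem_closure_iff]
  intro δ hδ
  obtain ⟨ε, hε, hLε⟩ := Metric.continuousAt_iff.mp
    (hL.continuousAt (x := fun i : s => pairing (i : Fin d → QBar) l.y)) δ hδ
  obtain ⟨n, hn⟩ := (h ε hε).exists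
  refine ⟨l.iterate n, ⟨n, rfl⟩, ?_⟩
  have := hLε (x := fun i : s => pairing (i : Fin d → QBar) (l.iterate n)) ((dist_pi_lt_iff hε).mpr fun i => by
    rw [dist_eq_norm]
    exact hn i)
  rwa [hLz, hLz, dist_comm] at this

theorem exists_invariant (hy : l.y ∉ closure l.orbit) :
    ∃ P : Set (Fin d → ℂ), IsClosed P ∧ IsSemialgebraic P ∧ l.IsInvariant P := by
  classical
  by_cases hyV : l.y ∈ l.orbitSpan
  swap
  · exact l.exists_invariant_of_eventual hy l.isClosedSemialgebraic_orbitSpan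
      (fun z hz => l.mulVec_mem_orbitSpan hz) 0 (l.iterate_mem_orbitSpan 0) hyV
  by_contra hno
  obtain ⟨s, c, hgen, hspan⟩ := l.exists_span_generalizedEigenvectors
  have hsub (f : Fin d → QBar) (c : QBar) (j : ℕ) :
      l.dualAction (((l.dualAction - c • 1) ^ j) f) - c • ((l.dualAction - c • 1) ^ j) f =
        ((l.dualAction - c • 1) ^ (j + 1)) f := by
    rw [pow_succ', Module.End.mul_apply]
    simp
  let good (i : s) : Prop := ‖(c i : ℂ)‖ = 1 ∧
    l.dualAction i - c i • (i : Fin d → QBar) ∈ l.annihilator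
  -- Without an invariant, every functional that does not simply rotate tends to zero on the orbit
  -- and vanishes at `y`.
  have hbad (i : s) (hi : ¬ good i) :
      Tendsto (fun n => pairing i (l.iterate n)) atTop (𝓝 0) ∧ pairing i l.y = 0 := by
    obtain ⟨k, hk⟩ := hgen i
    by_cases hW : (i : Fin d → QBar) ∈ l.annihilator
    · exact ⟨tendsto_const_nhds.congr fun n => (hW n).symm, hyV _ hW⟩
    obtain ⟨j, hj, hj'⟩ := l.exists_last_notMem hk hW
    rw [← hsub] at hj'
    rcases lt_trichotomy ‖(c i : ℂ)‖ 1 with hlt | heq | hgt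
    · refine ⟨l.tendsto_pairing_iterate_zero hlt hk, ?_⟩
      by_contra h0
      exact hno (l.exists_invariant_of_norm_lt_one hy hk hlt h0)
    -- For `j = 0` the functional is itself an eigenvector modulo the annihilator, hence good;
    -- otherwise the vectors at `j - 1` and `j` of the chain form a Jordan block.
    · cases j with
      | zero => exact absurd ⟨heq, by simpa using hj'⟩ hi
      | succ j => exact absurd (l.exists_invariant_of_jordan_block hy (hsub _ _ j) hj' hj heq) hno
    · exact absurd (l.exists_invariant_of_one_lt_norm hy hj' hj hgt) hno
  have hmonomial (a b : {i // good i} → ℕ)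
      (hab : ∏ i : {i // good i}, (c i : ℂ) ^ a i * conj (c i : ℂ) ^ b i = 1) :
      ∏ i : {i // good i}, pairing i l.x ^ a i * conj (pairing i l.x) ^ b i =
        ∏ i : {i // good i}, pairing i l.y ^ a i * conj (pairing i l.y) ^ b i := by
    by_contra hne
    exact hno (l.exists_invariant_of_monomial hy (fun i => i.2.2) hab hne)
  refine hy (l.mem_closure_orbit_of_frequently hspan fun ε hε => ?_)
  have hfreq := frequently_norm_pow_mul_sub_lt (Λ := fun i : {i // good i} => (c i : ℂ))
    (fun i => i.2.1) (fun i => pairing (i : Fin d → QBar) l.x)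
    (fun i => pairing (i : Fin d → QBar) l.y) hmonomial hε
  have hev : ∀ᶠ n in atTop, ∀ i, ¬ good i → ‖pairing i (l.iterate n) - pairing i l.y‖ < ε := by
    rw [eventually_all]
    intro i
    by_cases hi : good i
    · exact Eventually.of_forall fun n h => absurd hi h
    · have h := (hbad i hi).1.norm
      rw [norm_zero] at h
      refine (h.eventually (gt_mem_nhds hε)).mono fun n hn _ => ?_
      rwa [(hbad i hi).2, sub_zero]
  -- Rotating coordinates are close infinitely often, the others eventually always, so all are close
  -- at a common time.
  refine (hfreq.and_eventually hev).mono fun n ⟨h1, h2⟩ i => ?_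
  by_cases hi : good i
  · refine lt_of_le_of_lt (le_of_eq_of_le ?_ (norm_le_pi_norm _ (⟨i, hi⟩ : {i // good i}))) h1
    simp [l.pairing_iterate_of_sub_mem hi.2]
  · exact h2 i hi

theorem orbit_subset_of_isInvariant {P : Set (Fin d → ℂ)} (hP : l.IsInvariant P) :
    l.orbit ⊆ P := by
  rintro _ ⟨n, rfl⟩
  change l.iterate n ∈ P
  induction n with
  | zero => exact l.iterate_zero ▸ hP.source_mem
  | succ n ih => exact l.iterate_succ n ▸ hP.stable ⟨_, ih, rfl⟩

end OrbitInstance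

end OrbitProblem

theorem corollary3p9 {d : ℕ} (l : OrbitProblem.OrbitInstance d) :
    (∃ P : Set (Fin d → ℂ), IsClosed P ∧ OrbitProblem.IsSemialgebraic P ∧ l.IsInvariant P) ↔
      l.y ∉ closure l.orbit := by
  refine ⟨?_, l.exists_invariant⟩
  rintro ⟨P, hclosed, -, hP⟩ hy
  exact hP.target_notMem (closure_minimal (l.orbit_subset_of_isInvariant hP) hclosed hy)
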